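/- Write $\mathbb{N}_0=\{0,1,2,\dots\}$. Besides ordinary numbers $k\in\mathbb{N}_0$ we use barred symbols $\bar k$, and set $|k|=|\bar k|=k$, $\operatorname{sgn}(k)=1$, $\operatorname{sgn}(\bar k)=-1$; $\{2\}^a$ denotes $2$ repeated $a$ times. For a string $\mathbf{s}=(s_1,\dots,s_m)$ of such (possibly barred) numbers put $$\zeta(\mathbf{s})=\sum_{k_1>\cdots>k_m\ge1}\ \prod_{j=1}^m\frac{\operatorname{sgn}(s_j)^{k_j}}{k_j^{|s_j|}},\qquad \zeta^\star(\mathbf{s})=\sum_{k_1\ge\cdots\ge k_m\ge1}\ \prod_{j=1}^m\frac{\operatorname{sgn}(s_j)^{k_j}}{k_j^{|s_j|}}.$$ For $0<q<1$ let $[k]=1+q+\cdots+q^{k-1}$. For $r\in\mathbb{Z}$ and $k\ge1$ let $Q(r,k)=rk(k-1)/2$ if $r>0$ and $Q(r,k)=rk(k-1)/2-k$ if $r\le0$. For $t_j\in\mathbb{N}_0$ and $r_j\in\mathbb{Z}$ put $$\zeta^\star[\mathbf{s}]=\sum_{k_1\ge\cdots\ge k_m\ge1}\ \prod_{j=1}^m\frac{\operatorname{sgn}(s_j)^{k_j}q^{k_j}}{[k_j]^{|s_j|}},$$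 $$\mathfrak{z}[s_1,\dots,s_m;t_1,\dots,t_m;r_1,\dots,r_m]=\sum_{k_1>\cdots>k_m\ge1}\ \prod_{j=1}^m\frac{\operatorname{sgn}(s_j)^{k_j}q^{t_jk_j+Q(r_j,k_j)}(1+q^{k_j})}{[k_j]^{|s_j|}}.$$ (1) For all integers $a\ge1$ and $b,c,d\ge0$, all the series below converge absolutely and $$\begin{aligned} \zeta^{\star}(\{2\}^{a},1,\{2\}^{b},1,\{2\}^{c},3,\{2\}^{d},1) ={}&2\,\zeta(2a+2b+2c+2d+6)+4\,\zeta(2a+1,2b+2c+2d+5)\\ &+4\,\zeta(2a+2b+2,2c+2d+4)+4\,\zeta(\overline{2a+2b+2c+4},\overline{2d+2})\\ &+8\,\zeta(2a+1,2b+1,2c+2d+4)+8\,\zeta(2a+1,\overline{2b+2c+3},\overline{2d+2})\\ &+8\,\zeta(2a+2b+2,\overline{2c+2},\overline{2d+2})+16\,\zeta(2a+1,2b+1,\overline{2c+2},\overline{2d+2}). \end{aligned}$$ (2) For all integers $a,b,c,d\ge0$ and every real $q$ with $0<q<1$, all the series below converge absolutely and $$\begin{aligned} \zeta^{\star}[\{2\}^{a},1,\{2\}^{b},1,\{2\}^{c},3,\{2\}^{d},1]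 ={}&\mathfrak{z}[2a+2b+2c+2d+6;\,a+b+c+d+4;\,2]\\ &+\mathfrak{z}[2a+1,2b+2c+2d+5;\,a+1,b+c+d+3;\,2,0]\\ &+\mathfrak{z}[2a+2b+2,2c+2d+4;\,a+b+2,c+d+2;\,2,0]\\ &+\mathfrak{z}[\overline{2a+2b+2c+4},\overline{2d+2};\,a+b+c+3,d+1;\,1,1]\\ &+\mathfrak{z}[2a+1,2b+1,2c+2d+4;\,a+1,b+1,c+d+2;\,2,0,0]\\ &+\mathfrak{z}[2a+1,\overline{2b+2c+3},\overline{2d+2};\,a+1,b+c+2,d+1;\,2,-1,1]\\ &+\mathfrak{z}[2a+2b+2,\overline{2c+2},\overline{2d+2};\,a+b+2,c+1,d+1;\,2,-1,1]\\ &+\mathfrak{z}[2a+1,2b+1,\overline{2c+2},\overline{2d+2};\,a+1,b+1,c+1,d+1;\,2,0,-1,1]. \end{aligned}$$ -/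

import Mathlib

noncomputable section

namespace QMZV

/-- A signed number: either `k` (`pos k`) or its barred version (`bar k`), with `k : ℕ`. -/
inductive SignedNat where
  | pos (k : ℕ)
  | bar (k : ℕ)

/-- The absolute value: `|k| = |bar k| = k`. -/
def SignedNat.abs : SignedNat → ℕ
  | .pos k => k
  | .bar k => k

/-- The sign: `sgn k = 1` and `sgn (bar k) = -1`. -/
def SignedNat.sgn : SignedNat → ℝ
  | .pos _ => 1
  | .bar _ => -1

/-- Index tuples `k₁ > ⋯ > k_m ≥ 1`. -/
abbrev StrictTuple (m : ℕ) : Type :=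
  {k : Fin m → ℕ // StrictAnti k ∧ ∀ j, 1 ≤ k j}

/-- Index tuples `k₁ ≥ ⋯ ≥ k_m ≥ 1`. -/
abbrev WeakTuple (m : ℕ) : Type :=
  {k : Fin m → ℕ // Antitone k ∧ ∀ j, 1 ≤ k j}

/-! ### Alternating Euler sums -/

/-- The summand `∏ⱼ sgn(sⱼ)^{kⱼ} / kⱼ^{|sⱼ|}`. -/
def eulerTerm {m : ℕ} (s : Fin m → SignedNat) (k : Fin m → ℕ) : ℝ :=
  ∏ j, (s j).sgn ^ k j / (k j : ℝ) ^ (s j).abs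

/-- Absolute convergence of the series that defines `ζ(s)`. -/
def EulerConverges {m : ℕ} (s : Fin m → SignedNat) : Prop :=
  Summable fun k : StrictTuple m => eulerTerm s k.1

/-- The alternating Euler sum `ζ(s)`. -/
def euler {m : ℕ} (s : Fin m → SignedNat) : ℝ :=
  ∑' k : StrictTuple m, eulerTerm s k.1

/-- Absolute convergence of the series that defines `ζ⋆(s)`. -/
def EulerStarConverges {m : ℕ} (s : Fin m → SignedNat) : Prop :=
  Summable fun k : WeakTuple m => eulerTerm s k.1

/-- The star version `ζ⋆(s)`. -/
def eulerStar {m : ℕ} (s : Fin m → SignedNat) : ℝ :=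
  ∑' k : WeakTuple m, eulerTerm s k.1

/-! ### q-analogs -/

/-- The `q`-integer `[n] = 1 + q + ⋯ + q^{n-1}`. -/
def qInt (q : ℝ) (n : ℕ) : ℝ :=
  ∑ i ∈ Finset.range n, q ^ i

/-- The summand `∏ⱼ sgn(sⱼ)^{kⱼ} q^{kⱼ} / [kⱼ]^{|sⱼ|}`. -/
def qTerm (q : ℝ) {m : ℕ} (s : Fin m → SignedNat) (k : Fin m → ℕ) : ℝ :=
  ∏ j, (s j).sgn ^ k j * q ^ k j / qInt q (k j) ^ (s j).abs

/-- Absolute convergence of the series that defines `ζ⋆[s]`. -/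
def QStarConverges (q : ℝ) {m : ℕ} (s : Fin m → SignedNat) : Prop :=
  Summable fun k : WeakTuple m => qTerm q s k.1

/-- The `q`-multiple zeta star value `ζ⋆[s]`. -/
def qStar (q : ℝ) {m : ℕ} (s : Fin m → SignedNat) : ℝ :=
  ∑' k : WeakTuple m, qTerm q s k.1

/-- The set `ℤ ∪ {θ}`. -/
inductive IntTheta where
  | int (r : ℤ)
  | theta

/-- `Q(r,k)` is `r k (k-1) / 2` for `r > 0`, `r k (k-1) / 2 - k` for `r ≤ 0`, and `0` for `r = θ`;
the division is exact. -/
def Q : IntTheta → ℕ → ℤ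
  | .int r, k =>
      if 0 < r then r * (k : ℤ) * ((k : ℤ) - 1) / 2 else r * (k : ℤ) * ((k : ℤ) - 1) / 2 - (k : ℤ)
  | .theta, _ => 0

/-- The summand `∏ⱼ sgn(sⱼ)^{kⱼ} q^{tⱼ kⱼ + Q(rⱼ,kⱼ)} (1 + q^{kⱼ}) / [kⱼ]^{|sⱼ|}`. -/
def mollTerm (q : ℝ) {m : ℕ} (s : Fin m → SignedNat) (t : Fin m → ℕ) (r : Fin m → IntTheta)
    (k : Fin m → ℕ) : ℝ :=
  ∏ j, (s j).sgn ^ k j * q ^ ((t j : ℤ) * (k j : ℤ) + Q (r j) (k j)) * (1 + q ^ k j) /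
    qInt q (k j) ^ (s j).abs

/-- Absolute convergence of the series that defines `𝔷[s; t; r]`. -/
def MollConverges (q : ℝ) {m : ℕ} (s : Fin m → SignedNat) (t : Fin m → ℕ)
    (r : Fin m → IntTheta) : Prop :=
  Summable fun k : StrictTuple m => mollTerm q s t r k.1

/-- The mollified companion `𝔷[s; t; r]`. -/
def moll (q : ℝ) {m : ℕ} (s : Fin m → SignedNat) (t : Fin m → ℕ) (r : Fin m → IntTheta) : ℝ :=
  ∑' k : StrictTuple m, mollTerm q s t r k.1

/-- The string `({2}^a, 1, {2}^b, 1, {2}^c, 3, {2}^d, 1)`. -/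
def keyString (a b c d : ℕ) : List SignedNat :=
  List.replicate a (.pos 2) ++ [.pos 1] ++ List.replicate b (.pos 2) ++ [.pos 1] ++
    List.replicate c (.pos 2) ++ [.pos 3] ++ List.replicate d (.pos 2) ++ [.pos 1]

end QMZV

end

open QMZV

/-!
Write `K(n, k) = [n]!² / ([n-k]! [n+k]!)`, with value `0` for `k > n`. The star sum of a string,
restricted to `k₁ ≤ n`, is of the form `∑_k K(n, k) q^{k(k-1)} (1 + q^k) α_k`, and putting a letter
in front of the string acts on the coefficients `α` alone. A letter `2` multiplies `α_k` by
`q^k / [k]²`, because of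
`(K(n+1, k) - K(n, k)) q^k / [k]² = K(n+1, k) q^{n+1} / [n+1]²`.
For a letter `1` or `3` one first divides, or multiplies, by `[n]`; Abel summation against the
kernel turns this into multiplication by `[k]` plus a partial sum, which becomes a new inner
summation (alternating for `3`, whence the bars). So each `1` and each `3` in front of the
final `1` doubles the number of terms, and three such letters yield eight.
Finally `K(n, k) → 1` as `n → ∞`, and dominated convergence replaces the truncated sums by the full
ones; since the summands of the star sum are nonnegative, this also proves its convergence. At
`q = 1` every factor `1 + q^k` becomes `2`, which gives the powers of `2` in the classical identity.
-/

namespace QMZV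

open Finset Filter Topology

variable {q : ℝ}

/-! ### `q`-integers -/

lemma qInt_zero (q : ℝ) : qInt q 0 = 0 := by simp [qInt]

lemma qInt_one_left (n : ℕ) : qInt 1 n = n := by simp [qInt]

lemma qInt_add (q : ℝ) (m n : ℕ) : qInt q (m + n) = qInt q m + q ^ m * qInt q n := by
  simp [qInt, sum_range_add, pow_add, mul_sum]

lemma qInt_add_self (q : ℝ) (n : ℕ) : qInt q (n + n) = (1 + q ^ n) * qInt q n := by
  rw [qInt_add]; ring

lemma qInt_nonneg (hq : 0 < q) (n : ℕ) : 0 ≤ qInt q n :=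
  sum_nonneg fun _ _ => by positivity

lemma qInt_mono (hq : 0 < q) : Monotone (qInt q) := fun _ _ h =>
  sum_le_sum_of_subset_of_nonneg (range_mono h) fun _ _ _ => by positivity

lemma one_le_qInt (hq : 0 < q) {n : ℕ} (hn : 1 ≤ n) : 1 ≤ qInt q n := by
  simpa [qInt] using qInt_mono hq hn

lemma qInt_pos (hq : 0 < q) {n : ℕ} (hn : 1 ≤ n) : 0 < qInt q n :=
  one_pos.trans_le (one_le_qInt hq hn)

lemma natCast_mul_pow_le_qInt (hq : 0 < q) (hq1 : q ≤ 1) (n : ℕ) : n * q ^ n ≤ qInt q n := by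
  calc (n : ℝ) * q ^ n = ∑ _i ∈ range n, q ^ n := by simp
    _ ≤ qInt q n := sum_le_sum fun i hi =>
        pow_le_pow_of_le_one hq.le hq1 (mem_range.1 hi).le

lemma qInt_sq_sub_mul (q : ℝ) {n k : ℕ} (h : k ≤ n) :
    q ^ k * (qInt q n ^ 2 - qInt q (n - k) * qInt q (n + k)) = q ^ n * qInt q k ^ 2 := by
  obtain ⟨d, rfl⟩ := Nat.exists_eq_add_of_le h
  have hcomm : qInt q k + q ^ k * qInt q d = qInt q d + q ^ d * qInt q k := by
    rw [← qInt_add, ← qInt_add, add_comm]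
  rw [Nat.add_sub_cancel_left, show k + d + k = d + (k + k) by ring, qInt_add q d,
    qInt_add_self, qInt_add q k d, pow_add]
  linear_combination q ^ k * (qInt q k + q ^ k * qInt q d + qInt q d) * hcomm

lemma tendsto_qInt_div_qInt_add (hq : 0 < q) (hq1 : q ≤ 1) (d : ℕ) :
    Tendsto (fun n => qInt q n / qInt q (n + d)) atTop (𝓝 1) := by
  have hlim : Tendsto (fun n : ℕ => 1 - qInt q d / n) atTop (𝓝 1) := by
    simpa using (tendsto_natCast_atTop_atTop.const_div_atTop (qInt q d)).const_sub 1
  refine tendsto_of_tendsto_of_tendsto_of_le_of_le' hlim tendsto_const_nhds ?_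
    (.of_forall fun n => div_le_one_of_le₀ (qInt_mono hq (by lia)) (qInt_nonneg hq _))
  filter_upwards [eventually_ge_atTop 1] with n hn
  have hpos : 0 < qInt q (n + d) := qInt_pos hq (by lia)
  have hbound : q ^ n * qInt q d / qInt q (n + d) ≤ qInt q d / n := by
    rw [div_le_div_iff₀ hpos (by positivity)]
    calc q ^ n * qInt q d * n = qInt q d * (n * q ^ n) := by ring
      _ ≤ qInt q d * qInt q (n + d) := mul_le_mul_of_nonneg_left
          ((natCast_mul_pow_le_qInt hq hq1 n).trans (qInt_mono hq (by lia))) (qInt_nonneg hq d)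
  calc 1 - qInt q d / n ≤ 1 - q ^ n * qInt q d / qInt q (n + d) := sub_le_sub_left hbound 1
    _ = qInt q n / qInt q (n + d) := by
      rw [one_sub_div hpos.ne', qInt_add, add_sub_cancel_right]

/-! ### The kernel -/

/-- The kernel `[n]!² / ([n-k]! [n+k]!)`, written as a product that vanishes for `k > n`. -/
noncomputable def kernel (q : ℝ) (n k : ℕ) : ℝ :=
  ∏ i ∈ range k, qInt q (n - i) / qInt q (n + i + 1)

lemma kernel_zero_right (q : ℝ) (n : ℕ) : kernel q n 0 = 1 := by simp [kernel]

lemma kernel_eq_zero_of_lt (q : ℝ) {n k : ℕ} (h : n < k) : kernel q n k = 0 :=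
  prod_eq_zero (mem_range.2 h) (by simp [qInt_zero])

lemma kernel_nonneg (hq : 0 < q) (n k : ℕ) : 0 ≤ kernel q n k :=
  prod_nonneg fun _ _ => div_nonneg (qInt_nonneg hq _) (qInt_nonneg hq _)

lemma kernel_le_one (hq : 0 < q) (n k : ℕ) : kernel q n k ≤ 1 :=
  prod_le_one (fun _ _ => div_nonneg (qInt_nonneg hq _) (qInt_nonneg hq _)) fun i _ =>
    div_le_one_of_le₀ (qInt_mono hq (by lia)) (qInt_nonneg hq _)

lemma tendsto_kernel (hq : 0 < q) (hq1 : q ≤ 1) (k : ℕ) :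
    Tendsto (fun n => kernel q n k) atTop (𝓝 1) := by
  have hfactor (i : ℕ) : Tendsto (fun n => qInt q (n - i) / qInt q (n + i + 1)) atTop (𝓝 1) := by
    refine ((tendsto_qInt_div_qInt_add hq hq1 (2 * i + 1)).comp
      (tendsto_sub_atTop_nat i)).congr' ?_
    filter_upwards [eventually_ge_atTop i] with n hn
    rw [Function.comp_apply, show n - i + (2 * i + 1) = n + i + 1 by lia]
  simpa [kernel] using tendsto_finsetProd (range k) fun i _ => hfactor i

lemma qInt_mul_kernel_succ_right (hq : 0 < q) (n k : ℕ) :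
    qInt q (n + k + 1) * kernel q n (k + 1) = qInt q (n - k) * kernel q n k := by
  have := (qInt_pos hq (show 1 ≤ n + k + 1 by lia)).ne'
  rw [kernel, prod_range_succ, ← kernel]
  field_simp

lemma qInt_mul_kernel_succ_left (hq : 0 < q) (n k : ℕ) :
    qInt q (n + 1) ^ 2 * kernel q n k =
      qInt q (n + 1 - k) * qInt q (n + 1 + k) * kernel q (n + 1) k := by
  induction k with
  | zero => simp [kernel_zero_right, sq]
  | succ k ih =>
    have hne := (qInt_pos hq (show 1 ≤ n + k + 1 by lia)).ne'
    have hn := qInt_mul_kernel_succ_right hq n k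
    have hn1 := qInt_mul_kernel_succ_right hq (n + 1) k
    rw [show n + 1 + k = n + k + 1 by ring] at ih
    rw [Nat.add_sub_add_right, ← add_assoc (n + 1) k 1]
    apply mul_left_cancel₀ hne
    linear_combination qInt q (n + 1) ^ 2 * hn + qInt q (n - k) * ih
      - qInt q (n + k + 1) * qInt q (n - k) * hn1

lemma kernel_succ_sub (hq : 0 < q) {n k : ℕ} (hk : 1 ≤ k) (hkn : k ≤ n + 1) :
    (kernel q (n + 1) k - kernel q n k) * (q ^ k / qInt q k ^ 2) =
      q ^ (n + 1) / qInt q (n + 1) ^ 2 * kernel q (n + 1) k := by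
  have hn0 := (qInt_pos hq (show 1 ≤ n + 1 by lia)).ne'
  have hk0 := (qInt_pos hq hk).ne'
  field_simp
  linear_combination kernel q (n + 1) k * qInt_sq_sub_mul q hkn
    - q ^ k * qInt_mul_kernel_succ_left hq n k

/-! ### The kernel transform -/

lemma choose_two_succ (k : ℕ) : (k + 1).choose 2 = k.choose 2 + k := by
  rw [Nat.choose_succ_succ' k 1, Nat.choose_one_right, add_comm]

/-- The transform `∑_{k=1}^n K(n,k) q^{k(k-1)} (1+q^k) α_k` of a sequence `α`, where `K` is the
kernel. -/
noncomputable def transform (q : ℝ) (n : ℕ) (α : ℕ → ℝ) : ℝ :=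
  ∑ k ∈ Icc 1 n, kernel q n k * (q ^ (2 * k.choose 2) * (1 + q ^ k)) * α k

lemma transform_congr {n : ℕ} {α β : ℕ → ℝ} (h : ∀ k, 1 ≤ k → α k = β k) :
    transform q n α = transform q n β :=
  sum_congr rfl fun k hk => by rw [h k (mem_Icc.1 hk).1]

lemma transform_add (n : ℕ) (α β : ℕ → ℝ) :
    (transform q n fun k => α k + β k) = transform q n α + transform q n β := by
  simp only [transform, mul_add, sum_add_distrib]

lemma transform_succ (hq : 0 < q) (n : ℕ) (α : ℕ → ℝ) :
    (transform q (n + 1) fun k => q ^ k / qInt q k ^ 2 * α k) =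
      (transform q n fun k => q ^ k / qInt q k ^ 2 * α k) +
        q ^ (n + 1) / qInt q (n + 1) ^ 2 * transform q (n + 1) α := by
  have hextend : (transform q n fun k => q ^ k / qInt q k ^ 2 * α k) =
      ∑ k ∈ Icc 1 (n + 1), kernel q n k * (q ^ (2 * k.choose 2) * (1 + q ^ k)) *
        (q ^ k / qInt q k ^ 2 * α k) := by
    rw [sum_Icc_succ_top (by lia), kernel_eq_zero_of_lt q n.lt_succ_self, transform]
    simp
  rw [hextend, transform, transform, mul_sum, ← sum_add_distrib]
  refine sum_congr rfl fun k hk => ?_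
  obtain ⟨hk1, hkn⟩ := mem_Icc.1 hk
  linear_combination q ^ (2 * k.choose 2) * (1 + q ^ k) * α k * kernel_succ_sub hq hk1 hkn

theorem sum_div_sq_mul_transform (hq : 0 < q) (α : ℕ → ℝ) (n : ℕ) :
    ∑ m ∈ Icc 1 n, q ^ m / qInt q m ^ 2 * transform q m α =
      transform q n fun k => q ^ k / qInt q k ^ 2 * α k := by
  induction n with
  | zero => simp [transform]
  | succ n ih => rw [sum_Icc_succ_top (by lia), ih, transform_succ hq]

lemma kernel_telescope (hq : 0 < q) {n N : ℕ} (hN : N < n) {φ S : ℕ → ℝ}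
    (hS : S (N + 1) = S N + ((q ^ (N + 1))⁻¹ + 1) * φ (N + 1)) :
    kernel q n (N + 1) * (q ^ (2 * (N + 1).choose 2) * (1 + q ^ (N + 1))) *
        (qInt q (N + 1) * (φ (N + 1) + S N) - qInt q n * φ (N + 1)) =
      S N * q ^ (2 * (N + 1).choose 2) * (qInt q (n - N) * kernel q n N) -
        S (N + 1) * q ^ (2 * (N + 2).choose 2) *
          (qInt q (n - (N + 1)) * kernel q n (N + 1)) := by
  obtain ⟨m, rfl⟩ := Nat.exists_eq_add_of_lt hN
  have hn : qInt q (N + m + 1) = qInt q (N + 1) + q ^ (N + 1) * qInt q m := by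
    rw [← qInt_add]; congr 1; ring
  have hnN : qInt q (N + m + 1 + N + 1) =
      (1 + q ^ (N + 1)) * qInt q (N + 1) + q ^ (N + 1) * q ^ (N + 1) * qInt q m := by
    rw [← qInt_add_self, ← pow_add, ← qInt_add]; congr 1; ring
  have hx : q ^ (N + 1) * (q ^ (N + 1))⁻¹ = 1 := mul_inv_cancel₀ (pow_pos hq _).ne'
  have hpow : q ^ (2 * (N + 2).choose 2) =
      q ^ (2 * (N + 1).choose 2) * (q ^ (N + 1) * q ^ (N + 1)) := by
    rw [choose_two_succ (N + 1)]; ring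
  rw [← qInt_mul_kernel_succ_right hq, hnN, hn, hS, hpow, show N + m + 1 - (N + 1) = m by lia]
  linear_combination (kernel q (N + m + 1) (N + 1) * q ^ (2 * (N + 1).choose 2) * φ (N + 1) *
    q ^ (N + 1) * qInt q m) * hx

/-- Abel summation against the kernel: `φ_k` is, up to a power of `q`, the increment of `S`. -/
theorem transform_qInt_mul (hq : 0 < q) (n : ℕ) {φ S : ℕ → ℝ}
    (hS : ∀ k, S (k + 1) = S k + ((q ^ (k + 1))⁻¹ + 1) * φ (k + 1)) :
    (transform q n fun k => qInt q k * (φ k + S (k - 1))) =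
      qInt q n * (S 0 + transform q n φ) := by
  have hpartial : ∀ N ≤ n, ∑ k ∈ Icc 1 N, kernel q n k * (q ^ (2 * k.choose 2) * (1 + q ^ k)) *
      (qInt q k * (φ k + S (k - 1)) - qInt q n * φ k) =
        qInt q n * S 0 - S N * q ^ (2 * (N + 1).choose 2) * (qInt q (n - N) * kernel q n N) := by
    intro N
    induction N with
    | zero => simp [kernel_zero_right, mul_comm]
    | succ N ih =>
      intro hN
      rw [sum_Icc_succ_top (by lia), ih (by lia), Nat.add_sub_cancel, kernel_telescope hq hN (hS N)]
      ring
  have htotal := hpartial n le_rfl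
  rw [Nat.sub_self, qInt_zero, zero_mul, mul_zero, sub_zero] at htotal
  rw [mul_add, ← htotal, transform, transform, mul_sum, ← sum_add_distrib]
  exact sum_congr rfl fun k _ => by ring

lemma sum_div_mul_add_transform (hq : 0 < q) {α S : ℕ → ℝ}
    (hS : ∀ k, S (k + 1) = S k + ((q ^ (k + 1))⁻¹ + 1) * α (k + 1)) (n : ℕ) :
    ∑ m ∈ Icc 1 n, q ^ m / qInt q m * (S 0 + transform q m α) =
      transform q n fun k => q ^ k / qInt q k * (α k + S (k - 1)) := by
  trans transform q n fun k => q ^ k / qInt q k ^ 2 * (qInt q k * (α k + S (k - 1)))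
  · rw [← sum_div_sq_mul_transform hq]
    refine sum_congr rfl fun m hm => ?_
    have := (qInt_pos hq (mem_Icc.1 hm).1).ne'
    rw [transform_qInt_mul hq m hS]
    field_simp
  · refine transform_congr fun k hk => ?_
    have := (qInt_pos hq hk).ne'
    field_simp

theorem sum_div_qInt (hq : 0 < q) (n : ℕ) :
    ∑ m ∈ Icc 1 n, q ^ m / qInt q m = transform q n fun k => q ^ k / qInt q k := by
  simpa [transform] using
    sum_div_mul_add_transform hq (α := fun _ => 0) (S := fun _ => 1) (by simp) n

theorem sum_div_mul_transform (hq : 0 < q) (α : ℕ → ℝ) (n : ℕ) :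
    ∑ m ∈ Icc 1 n, q ^ m / qInt q m * transform q m α =
      transform q n fun k => q ^ k / qInt q k *
        (α k + ∑ j ∈ Icc 1 (k - 1), ((q ^ j)⁻¹ + 1) * α j) := by
  simpa using sum_div_mul_add_transform hq (α := α)
    (S := fun k => ∑ j ∈ Icc 1 k, ((q ^ j)⁻¹ + 1) * α j)
    (fun k => sum_Icc_succ_top (by lia) _) n

/-- The partial sum `∑_{j=1}^k (-1)^j q^{j(j-1)/2} (1+q^j) β_j`, which an entry `3` produces. -/
noncomputable def altSum (q : ℝ) (β : ℕ → ℝ) (k : ℕ) : ℝ :=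
  ∑ j ∈ Icc 1 k, (-1) ^ j * q ^ j.choose 2 * (1 + q ^ j) * β j

lemma altSum_succ (q : ℝ) (β : ℕ → ℝ) (k : ℕ) :
    altSum q β (k + 1) = altSum q β k +
      (-1) ^ (k + 1) * q ^ (k + 1).choose 2 * (1 + q ^ (k + 1)) * β (k + 1) :=
  sum_Icc_succ_top (by lia) _

theorem transform_qInt_mul_eq_qInt_mul_transform (hq : 0 < q) (n : ℕ) (β : ℕ → ℝ) :
    (transform q n fun k => qInt q k * β k) = qInt q n *
      transform q n fun k => β k + (-1) ^ k * (q ^ k.choose 2)⁻¹ * altSum q β (k - 1) := by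
  have hS := transform_qInt_mul hq n
    (φ := fun k => β k + (-1) ^ k * (q ^ k.choose 2)⁻¹ * altSum q β (k - 1))
    (S := fun k => (-1) ^ k * (q ^ (k + 1).choose 2)⁻¹ * altSum q β k) fun k => ?_
  · rw [show altSum q β 0 = 0 by simp [altSum], mul_zero, zero_add] at hS
    rw [← hS]
    refine transform_congr fun k hk => ?_
    obtain ⟨j, rfl⟩ := Nat.exists_eq_add_of_le' hk
    rw [Nat.add_sub_cancel, pow_succ (-1 : ℝ)]
    ring
  · have hsign : ((-1 : ℝ) ^ k) ^ 2 = 1 := by rw [← pow_mul, mul_comm, pow_mul]; simp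
    simp only [altSum_succ, Nat.add_sub_cancel, choose_two_succ (k + 1), pow_add q _ (k + 1),
      pow_succ (-1 : ℝ)]
    have := (pow_pos hq (k + 1)).ne'
    field_simp
    linear_combination q ^ (k + 1).choose 2 * (1 + q ^ (k + 1)) * β (k + 1) * hsign

theorem sum_div_cube_mul_transform (hq : 0 < q) (α : ℕ → ℝ) (n : ℕ) :
    ∑ m ∈ Icc 1 n, q ^ m / qInt q m ^ 3 * transform q m α =
      transform q n fun k => q ^ k / qInt q k ^ 2 * (α k / qInt q k +
        (-1) ^ k * (q ^ k.choose 2)⁻¹ * altSum q (fun j => α j / qInt q j) (k - 1)) := by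
  rw [← sum_div_sq_mul_transform hq]
  refine sum_congr rfl fun m hm => ?_
  have hm0 := (qInt_pos hq (mem_Icc.1 hm).1).ne'
  have hα : transform q m α = transform q m fun k => qInt q k * (α k / qInt q k) :=
    transform_congr fun k hk => (mul_div_cancel₀ _ (qInt_pos hq hk).ne').symm
  rw [hα, transform_qInt_mul_eq_qInt_mul_transform hq]
  field_simp


/-! ### Index tuples with bounded entries -/

/-- The tuples in `[1, n]^m` that decrease by at least `e` from each entry to the later ones:
the index tuples of a truncated star sum for `e = 0`, and of a truncated strict sum for `e = 1`. -/
def gapTuples (e n m : ℕ) : Finset (Fin m → ℕ) :=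
  {k ∈ Fintype.piFinset fun _ : Fin m => Icc 1 n | ∀ i j, i < j → k j + e ≤ k i}

lemma mem_gapTuples {e n m : ℕ} {k : Fin m → ℕ} :
    k ∈ gapTuples e n m ↔ (∀ j, 1 ≤ k j ∧ k j ≤ n) ∧ ∀ i j, i < j → k j + e ≤ k i := by
  simp [gapTuples]

lemma mem_gapTuples_zero {n m : ℕ} {k : Fin m → ℕ} :
    k ∈ gapTuples 0 n m ↔ (Antitone k ∧ ∀ j, 1 ≤ k j) ∧ ∀ j, k j ≤ n := by
  rw [mem_gapTuples, forall_and, antitone_iff_forall_lt]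
  exact ⟨fun h => ⟨⟨h.2, h.1.1⟩, h.1.2⟩, fun h => ⟨⟨h.1.2, h.2⟩, h.1.1⟩⟩

lemma mem_gapTuples_one {n m : ℕ} {k : Fin m → ℕ} :
    k ∈ gapTuples 1 n m ↔ (StrictAnti k ∧ ∀ j, 1 ≤ k j) ∧ ∀ j, k j ≤ n := by
  rw [mem_gapTuples, forall_and]
  exact ⟨fun h => ⟨⟨h.2, h.1.1⟩, h.1.2⟩, fun h => ⟨⟨h.1.2, h.2⟩, fun i j hij => h.1.1 hij⟩⟩

lemma sum_gapTuples_zero (e n : ℕ) (F : (Fin 0 → ℕ) → ℝ) :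
    ∑ k ∈ gapTuples e n 0, F k = F ![] := by
  have : gapTuples e n 0 = {![]} := by
    ext k
    simp [mem_gapTuples, Subsingleton.elim k ![]]
  rw [this, sum_singleton]

lemma cons_mem_gapTuples {e n m x : ℕ} {k : Fin m → ℕ} :
    (Fin.cons x k : Fin (m + 1) → ℕ) ∈ gapTuples e n (m + 1) ↔
      x ∈ Icc 1 n ∧ k ∈ gapTuples e (x - e) m := by
  simp only [mem_gapTuples, mem_Icc, Fin.forall_fin_succ, Fin.cons_zero, Fin.cons_succ,
    Fin.succ_pos, Fin.not_lt_zero, Fin.succ_lt_succ_iff, false_imp_iff, true_imp_iff,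
    true_and]
  grind

lemma sum_gapTuples_succ (e n m : ℕ) (F : (Fin (m + 1) → ℕ) → ℝ) :
    ∑ k ∈ gapTuples e n (m + 1), F k =
      ∑ x ∈ Icc 1 n, ∑ k ∈ gapTuples e (x - e) m, F (Fin.cons x k) := by
  rw [sum_sigma']
  refine sum_bij' (fun k _ => ⟨k 0, Fin.tail k⟩) (fun p _ => Fin.cons p.1 p.2)
    (fun k hk => ?_) (fun p hp => ?_) (fun k _ => Fin.cons_self_tail k) (fun p _ => by simp)
    fun k _ => by rw [Fin.cons_self_tail]
  · rw [← Fin.cons_self_tail k, cons_mem_gapTuples] at hk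
    simpa using hk
  · simpa [cons_mem_gapTuples] using hp

/-! ### Truncated sums -/

/-- The star sum `ζ⋆[l]` restricted to the tuples with `k₁ ≤ n`. -/
noncomputable def truncStar (q : ℝ) (n : ℕ) (l : List SignedNat) : ℝ :=
  ∑ k ∈ gapTuples 0 n l.length, qTerm q l.get k

lemma truncStar_nil (q : ℝ) (n : ℕ) : truncStar q n [] = 1 :=
  (sum_gapTuples_zero 0 n _).trans (Fin.prod_univ_zero _)

lemma truncStar_cons (q : ℝ) (n : ℕ) (s : SignedNat) (l : List SignedNat) :
    truncStar q n (s :: l) = ∑ x ∈ Icc 1 n,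
      s.sgn ^ x * q ^ x / qInt q x ^ s.abs * truncStar q x l := by
  refine (sum_gapTuples_succ 0 n l.length _).trans (sum_congr rfl fun x _ => ?_)
  rw [truncStar, mul_sum]
  exact sum_congr rfl fun k _ => Fin.prod_univ_succ (n := l.length) _

/-- One column `(s; t; r)` of the index array of `𝔷[s; t; r]`. -/
structure MollEntry where
  s : SignedNat
  t : ℕ
  r : IntTheta

/-- The index array of `𝔷[s; t; r]`, as the list of its columns. -/
abbrev MollIndex := List MollEntry

namespace MollIndex

/-- The tuple of the values of `f` along a list. It is built with `vecCons` so that for an explicit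
list it unfolds to the `![…]` notation. -/
def vec {β : Type*} (f : MollEntry → β) : (I : MollIndex) → Fin I.length → β
  | [] => ![]
  | e :: I => Matrix.vecCons (f e) (vec f I)

lemma forall_vec {β : Type*} {f : MollEntry → β} {p : β → Prop} {I : MollIndex}
    (h : ∀ e ∈ I, p (f e)) : ∀ j, p (I.vec f j) := by
  induction I with
  | nil => exact fun j => j.elim0
  | cons e I ih =>
    rw [List.forall_mem_cons] at h
    exact Fin.cases h.1 (ih h.2)

/-- The first row of an index array. -/
abbrev s (I : MollIndex) : Fin I.length → SignedNat := vec MollEntry.s I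

/-- The second row of an index array. -/
abbrev t (I : MollIndex) : Fin I.length → ℕ := vec MollEntry.t I

/-- The third row of an index array. -/
abbrev r (I : MollIndex) : Fin I.length → IntTheta := vec MollEntry.r I

end MollIndex

/-- The factor of `mollTerm` that belongs to one column of the index array. -/
noncomputable def mollFactor (q : ℝ) (e : MollEntry) (k : ℕ) : ℝ :=
  e.s.sgn ^ k * q ^ ((e.t : ℤ) * (k : ℤ) + Q e.r k) * (1 + q ^ k) / qInt q k ^ e.s.abs

lemma mollTerm_cons (q : ℝ) (e : MollEntry) (I : MollIndex) (x : ℕ) (k : Fin I.length → ℕ) :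
    mollTerm q (MollIndex.s (e :: I)) (MollIndex.t (e :: I)) (MollIndex.r (e :: I))
      (Fin.cons x k : Fin (I.length + 1) → ℕ) = mollFactor q e x * mollTerm q I.s I.t I.r k :=
  Fin.prod_univ_succ (n := I.length) _

/-- The sum `𝔷[I]` restricted to the tuples with `k₁ ≤ n`. -/
noncomputable def truncMoll (q : ℝ) (n : ℕ) (I : MollIndex) : ℝ :=
  ∑ k ∈ gapTuples 1 n I.length, mollTerm q I.s I.t I.r k

lemma truncMoll_nil (q : ℝ) (n : ℕ) : truncMoll q n [] = 1 :=
  (sum_gapTuples_zero 1 n _).trans (Fin.prod_univ_zero _)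

lemma truncMoll_cons (q : ℝ) (n : ℕ) (e : MollEntry) (I : MollIndex) :
    truncMoll q n (e :: I) = ∑ x ∈ Icc 1 n, mollFactor q e x * truncMoll q (x - 1) I := by
  refine (sum_gapTuples_succ 1 n I.length _).trans (sum_congr rfl fun x _ => ?_)
  simp only [truncMoll, mul_sum, mollTerm_cons]

/-! ### Expansion of star sums -/

lemma Q_int (r : ℤ) (k : ℕ) : Q (.int r) k = r * k.choose 2 - if 0 < r then 0 else (k : ℤ) := by
  have hchoose : (k : ℤ) * (k - 1) = 2 * k.choose 2 := by
    induction k with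
    | zero => simp
    | succ k ih => rw [choose_two_succ]; push_cast; linear_combination ih
  have hr : r * k * (k - 1) = r * k.choose 2 * 2 := by linear_combination r * hchoose
  rw [Q, hr, Int.mul_ediv_cancel _ two_ne_zero]
  split_ifs <;> ring

namespace SignedNat

/-- Adds `m` to the absolute value. -/
def raise (m : ℕ) : SignedNat → SignedNat
  | .pos k => .pos (k + m)
  | .bar k => .bar (k + m)

/-- Adds or removes the bar. -/
def flip : SignedNat → SignedNat
  | .pos k => .bar k
  | .bar k => .pos k

@[simp] lemma abs_raise (m : ℕ) (s : SignedNat) : (s.raise m).abs = s.abs + m := by cases s <;> rfl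

@[simp] lemma sgn_raise (m : ℕ) (s : SignedNat) : (s.raise m).sgn = s.sgn := by cases s <;> rfl

@[simp] lemma abs_flip (s : SignedNat) : s.flip.abs = s.abs := by cases s <;> rfl

@[simp] lemma sgn_flip (s : SignedNat) : s.flip.sgn = -s.sgn := by cases s <;> simp [flip, sgn]

/-- The part of the exponent of `q` that the bar of a leading entry contributes. -/
def barShift : SignedNat → ℕ → ℤ
  | .pos _, _ => 0
  | .bar _, k => -(k.choose 2 : ℤ)

@[simp] lemma barShift_raise (m : ℕ) (s : SignedNat) : (s.raise m).barShift = s.barShift := by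
  cases s <;> rfl

/-- The third-row entry of a leading column. -/
def leadingTheta : SignedNat → IntTheta
  | .pos _ => .int 2
  | .bar _ => .int 1

/-- The third-row entry that a leading column receives when a `1` is put in front of it. -/
def thetaBehindOne : SignedNat → IntTheta
  | .pos _ => .int 0
  | .bar _ => .int (-1)

/-- The third-row entry that a leading column receives when a `3` is put in front of it. -/
def thetaBehindThree : SignedNat → IntTheta
  | .pos _ => .int 1
  | .bar _ => .theta

lemma Q_leadingTheta (s : SignedNat) (k : ℕ) :
    Q s.leadingTheta k = s.barShift k + 2 * k.choose 2 := by
  cases s <;> simp [leadingTheta, barShift, Q_int]; ring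

lemma Q_thetaBehindOne (s : SignedNat) (k : ℕ) : Q s.thetaBehindOne k = s.barShift k - k := by
  cases s <;> simp [thetaBehindOne, barShift, Q_int]

lemma Q_thetaBehindThree (s : SignedNat) (k : ℕ) :
    Q s.thetaBehindThree k = s.barShift k + k.choose 2 := by
  cases s
  · simp [thetaBehindThree, barShift, Q_int]
  · simp [thetaBehindThree, barShift, Q]

end SignedNat

/-- An index array whose leading third-row entry is still open: it depends on the letter that is
put in front, or is `leadingTheta` if nothing is. These arrays are the words into which a star sum
is expanded. -/
structure OpenIndex where
  s : SignedNat
  t : ℕ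
  tail : MollIndex

/-- The factor of the coefficient of an `OpenIndex` that belongs to its leading column. -/
noncomputable def headCoeff (q : ℝ) (s : SignedNat) (t k : ℕ) : ℝ :=
  s.sgn ^ k * q ^ ((t : ℤ) * (k : ℤ) + s.barShift k) / qInt q k ^ s.abs

lemma mollFactor_eq_headCoeff (hq : 0 < q) {e : MollEntry} {k : ℕ} {x : ℤ}
    (h : Q e.r k = e.s.barShift k + x) :
    mollFactor q e k = q ^ x * (1 + q ^ k) * headCoeff q e.s e.t k := by
  rw [mollFactor, headCoeff, h, ← add_assoc, zpow_add₀ hq.ne' _ x]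
  ring

lemma headCoeff_one_one (q : ℝ) (k : ℕ) : headCoeff q (.pos 1) 1 k = q ^ k / qInt q k := by
  simp [headCoeff, SignedNat.sgn, SignedNat.abs, SignedNat.barShift]

lemma div_mul_headCoeff (hq : 0 < q) (m : ℕ) (s : SignedNat) (t k : ℕ) :
    q ^ k / qInt q k ^ m * headCoeff q s t k = headCoeff q (s.raise m) (t + 1) k := by
  have hexp : ((t + 1 : ℕ) : ℤ) * k + s.barShift k = k + (t * k + s.barShift k) := by
    push_cast; ring
  simp only [headCoeff, SignedNat.sgn_raise, SignedNat.abs_raise, SignedNat.barShift_raise, hexp,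
    zpow_add₀ hq.ne' (k : ℤ), zpow_natCast, pow_add]
  ring

namespace OpenIndex

/-- The coefficient sequence, whose kernel transform is the truncated sum of the word. -/
noncomputable def coeff (q : ℝ) (w : OpenIndex) (k : ℕ) : ℝ :=
  headCoeff q w.s w.t k * truncMoll q (k - 1) w.tail

/-- Merges the leading column with a letter of absolute value `m`. -/
def raise (m : ℕ) (w : OpenIndex) : OpenIndex := ⟨w.s.raise m, w.t + 1, w.tail⟩

/-- Puts a letter `1` in front of the leading column. -/
def consOne (w : OpenIndex) : OpenIndex := ⟨.pos 1, 1, ⟨w.s, w.t, w.s.thetaBehindOne⟩ :: w.tail⟩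

/-- Puts a letter `3` in front of the leading column, to which it gives away one unit. -/
def consThree (w : OpenIndex) : OpenIndex :=
  ⟨.bar 2, 1, ⟨w.s.flip.raise 1, w.t, w.s.thetaBehindThree⟩ :: w.tail⟩

/-- The index array completed by `leadingTheta`. -/
def close (w : OpenIndex) : MollIndex := ⟨w.s, w.t, w.s.leadingTheta⟩ :: w.tail

lemma coeff_raise (hq : 0 < q) (m : ℕ) (w : OpenIndex) (k : ℕ) :
    (w.raise m).coeff q k = q ^ k / qInt q k ^ m * w.coeff q k := by
  rw [coeff, coeff, ← mul_assoc, div_mul_headCoeff hq]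
  rfl

lemma coeff_consOne (hq : 0 < q) (w : OpenIndex) (k : ℕ) :
    w.consOne.coeff q k =
      q ^ k / qInt q k * ∑ j ∈ Icc 1 (k - 1), ((q ^ j)⁻¹ + 1) * w.coeff q j := by
  rw [coeff, consOne, headCoeff_one_one, truncMoll_cons]
  refine congrArg _ (sum_congr rfl fun j _ => ?_)
  have := (pow_pos hq j).ne'
  rw [mollFactor_eq_headCoeff hq (w.s.Q_thetaBehindOne j), zpow_neg, zpow_natCast, coeff]
  field_simp

lemma coeff_consThree (hq : 0 < q) (w : OpenIndex) (k : ℕ) :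
    w.consThree.coeff q k = q ^ k / qInt q k ^ 2 *
      ((-1) ^ k * (q ^ k.choose 2)⁻¹ * altSum q (fun j => w.coeff q j / qInt q j) (k - 1)) := by
  have hhead : headCoeff q (.bar 2) 1 k =
      q ^ k / qInt q k ^ 2 * ((-1) ^ k * (q ^ k.choose 2)⁻¹) := by
    rw [headCoeff, SignedNat.barShift, zpow_add₀ hq.ne', zpow_neg]
    simp [SignedNat.sgn, SignedNat.abs]
    ring
  rw [coeff, consThree, hhead, truncMoll_cons, altSum, mul_assoc]
  congr 2
  refine sum_congr rfl fun j _ => ?_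
  simp only [mollFactor, coeff, headCoeff, SignedNat.sgn_raise, SignedNat.abs_raise,
    SignedNat.sgn_flip, SignedNat.abs_flip, SignedNat.Q_thetaBehindThree, ← add_assoc,
    zpow_add₀ hq.ne' _ (j.choose 2 : ℤ), zpow_natCast, neg_pow w.s.sgn, pow_succ (qInt q j)]
  ring

lemma sum_transform_raise (hq : 0 < q) (w : OpenIndex) (n : ℕ) :
    ∑ m ∈ Icc 1 n, q ^ m / qInt q m ^ 2 * transform q m (w.coeff q) =
      transform q n ((w.raise 2).coeff q) := by
  rw [sum_div_sq_mul_transform hq]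
  exact transform_congr fun k _ => (coeff_raise hq 2 w k).symm

lemma sum_transform_consOne (hq : 0 < q) (w : OpenIndex) (n : ℕ) :
    ∑ m ∈ Icc 1 n, q ^ m / qInt q m * transform q m (w.coeff q) =
      transform q n ((w.raise 1).coeff q) + transform q n (w.consOne.coeff q) := by
  rw [sum_div_mul_transform hq, ← transform_add]
  exact transform_congr fun k _ => by rw [coeff_raise hq, coeff_consOne hq, pow_one, mul_add]

lemma sum_transform_consThree (hq : 0 < q) (w : OpenIndex) (n : ℕ) :
    ∑ m ∈ Icc 1 n, q ^ m / qInt q m ^ 3 * transform q m (w.coeff q) =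
      transform q n ((w.raise 3).coeff q) + transform q n (w.consThree.coeff q) := by
  rw [sum_div_cube_mul_transform hq, ← transform_add]
  refine transform_congr fun k _ => ?_
  rw [coeff_raise hq, coeff_consThree hq, mul_add]
  ring

end OpenIndex

/-- The rules that expand the star sum of a string `l` over `1, 2, 3` ending in `1` into the sum,
over the words `w` of `W`, of the mollified companions of `w.close`. The string is read from the
right, so each rule says what putting one more letter in front does to the words. -/
inductive Expands : List SignedNat → List OpenIndex → Prop
  | one : Expands [.pos 1] [⟨.pos 1, 1, []⟩]
  | cons_two {l : List SignedNat} {W : List OpenIndex} (h : Expands l W) :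
      Expands (.pos 2 :: l) (W.map (.raise 2))
  | cons_one {l : List SignedNat} {W : List OpenIndex} (h : Expands l W) :
      Expands (.pos 1 :: l) (W.map (.raise 1) ++ W.map .consOne)
  | cons_three {l : List SignedNat} {W : List OpenIndex} (h : Expands l W) :
      Expands (.pos 3 :: l) (W.map (.raise 3) ++ W.map .consThree)

lemma sum_mul_sum_map {ι κ R : Type*} [NonUnitalNonAssocSemiring R] (u : Finset ι) (c : ι → R)
    (W : List κ) (F : κ → ι → R) :
    ∑ i ∈ u, c i * (W.map fun w => F w i).sum = (W.map fun w => ∑ i ∈ u, c i * F w i).sum := by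
  induction W with
  | nil => simp
  | cons w W ih => simp only [List.map_cons, List.sum_cons, mul_add, sum_add_distrib, ih]

namespace Expands

variable {l : List SignedNat} {W : List OpenIndex}

theorem truncStar_eq (hq : 0 < q) (h : Expands l W) (n : ℕ) :
    truncStar q n l = (W.map fun w => transform q n (w.coeff q)).sum := by
  induction h generalizing n with
  | one =>
    have hcoeff : OpenIndex.coeff q ⟨.pos 1, 1, []⟩ = fun k => q ^ k / qInt q k := by
      funext k
      rw [OpenIndex.coeff, truncMoll_nil, mul_one, headCoeff_one_one]
    simp [truncStar_cons, truncStar_nil, SignedNat.sgn, SignedNat.abs, sum_div_qInt hq, hcoeff]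
  | cons_two _ ih =>
    simp [truncStar_cons, SignedNat.sgn, SignedNat.abs, ih, sum_mul_sum_map,
      OpenIndex.sum_transform_raise hq, Function.comp_def]
  | cons_one _ ih =>
    simp [truncStar_cons, SignedNat.sgn, SignedNat.abs, ih, sum_mul_sum_map,
      OpenIndex.sum_transform_consOne hq, Function.comp_def]
  | cons_three _ ih =>
    simp [truncStar_cons, SignedNat.sgn, SignedNat.abs, ih, sum_mul_sum_map,
      OpenIndex.sum_transform_consThree hq, Function.comp_def]

lemma sgn_eq_one (h : Expands l W) : ∀ s ∈ l, s.sgn = 1 := by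
  induction h with
  | one => simp [SignedNat.sgn]
  | cons_two _ ih | cons_one _ ih | cons_three _ ih => exact List.forall_mem_cons.2 ⟨rfl, ih⟩

lemma forall_mem {p : OpenIndex → Prop} (h : Expands l W) (one : p ⟨.pos 1, 1, []⟩)
    (raise : ∀ m w, p w → p (w.raise m)) (consOne : ∀ w, p w → p w.consOne)
    (consThree : ∀ w, p w → p w.consThree) : ∀ w ∈ W, p w := by
  induction h with
  | one => simpa using one
  | cons_two _ ih => exact List.forall_mem_map.2 fun w hw => raise _ w (ih w hw)
  | cons_one _ ih =>
    exact List.forall_mem_append.2 ⟨List.forall_mem_map.2 fun w hw => raise _ w (ih w hw),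
      List.forall_mem_map.2 fun w hw => consOne w (ih w hw)⟩
  | cons_three _ ih =>
    exact List.forall_mem_append.2 ⟨List.forall_mem_map.2 fun w hw => raise _ w (ih w hw),
      List.forall_mem_map.2 fun w hw => consThree w (ih w hw)⟩

end Expands

/-! ### Passage to the limit -/

lemma OpenIndex.transform_coeff (hq : 0 < q) (w : OpenIndex) (n : ℕ) :
    transform q n (w.coeff q) = ∑ k ∈ gapTuples 1 n (w.tail.length + 1),
      kernel q n (k 0) * mollTerm q w.close.s w.close.t w.close.r k := by
  rw [sum_gapTuples_succ, transform]
  refine sum_congr rfl fun x _ => ?_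
  have hlead : mollFactor q ⟨w.s, w.t, w.s.leadingTheta⟩ x =
      q ^ (2 * x.choose 2) * (1 + q ^ x) * headCoeff q w.s w.t x := by
    rw [mollFactor_eq_headCoeff hq (w.s.Q_leadingTheta x)]
    norm_cast
  simp only [OpenIndex.close, mollTerm_cons, Fin.cons_zero, hlead, OpenIndex.coeff, truncMoll,
    mul_sum]
  exact sum_congr rfl fun k _ => by ring

lemma tendsto_sum_kernel_mul_mollTerm (hq : 0 < q) (hq1 : q ≤ 1) {m : ℕ}
    {s : Fin (m + 1) → SignedNat} {t : Fin (m + 1) → ℕ} {r : Fin (m + 1) → IntTheta}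
    (h : MollConverges q s t r) :
    Tendsto (fun n => ∑ k ∈ gapTuples 1 n (m + 1), kernel q n (k 0) * mollTerm q s t r k) atTop
      (𝓝 (moll q s t r)) := by
  have htsum (n : ℕ) : ∑ k ∈ gapTuples 1 n (m + 1), kernel q n (k 0) * mollTerm q s t r k =
      ∑' k : StrictTuple (m + 1), kernel q n (k.1 0) * mollTerm q s t r k.1 := by
    rw [← sum_subtype_of_mem (p := fun k => StrictAnti k ∧ ∀ j, 1 ≤ k j) _
      fun k hk => (mem_gapTuples_one.1 hk).1]
    refine (tsum_eq_sum fun k hk => ?_).symm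
    have hlt : n < k.1 0 := by
      by_contra! hle
      exact hk (mem_subtype.2 (mem_gapTuples_one.2
        ⟨k.2, fun j => (k.2.1.antitone (Fin.zero_le j)).trans hle⟩))
    rw [kernel_eq_zero_of_lt q hlt, zero_mul]
  simp only [htsum]
  refine tendsto_tsum_of_dominated_convergence h.norm (fun k => ?_) (.of_forall fun n k => ?_)
  · simpa using (tendsto_kernel hq hq1 (k.1 0)).mul_const (mollTerm q s t r k.1)
  · rw [norm_mul, Real.norm_of_nonneg (kernel_nonneg hq _ _)]
    exact mul_le_of_le_one_left (norm_nonneg _) (kernel_le_one hq _ _)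

lemma hasSum_of_tendsto_exhaustion {ι : Type*} {f : ι → ℝ} (hf : ∀ i, 0 ≤ f i)
    {A : ℕ → Finset ι} (hA : Monotone A) (hA' : ∀ i, ∃ n, i ∈ A n) {L : ℝ}
    (h : Tendsto (fun n => ∑ i ∈ A n, f i) atTop (𝓝 L)) : HasSum f L := by
  have hlim := tendsto_atTop_finset_of_monotone hA hA'
  have hmono : Monotone fun n => ∑ i ∈ A n, f i := fun a b hab =>
    sum_le_sum_of_subset_of_nonneg (hA hab) fun i _ _ => hf i
  have hsummable : Summable f := by
    refine summable_of_sum_le (c := L) hf fun u => ?_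
    obtain ⟨n, hn⟩ := (hlim.eventually (eventually_ge_atTop u)).exists
    exact (sum_le_sum_of_subset_of_nonneg hn fun i _ _ => hf i).trans (hmono.ge_of_tendsto h n)
  rw [tendsto_nhds_unique h (hsummable.hasSum.comp hlim)]
  exact hsummable.hasSum

lemma hasSum_qTerm_of_tendsto_truncStar (hq : 0 < q) {l : List SignedNat}
    (hl : ∀ s ∈ l, s.sgn = 1) {L : ℝ} (h : Tendsto (fun n => truncStar q n l) atTop (𝓝 L)) :
    HasSum (fun k : WeakTuple l.length => qTerm q l.get k.1) L := by
  classical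
  refine hasSum_of_tendsto_exhaustion (A := fun n => (gapTuples 0 n l.length).subtype _)
    (fun k => prod_nonneg fun j _ => ?_) (fun a b hab k hk => ?_) (fun k => ⟨∑ j, k.1 j, ?_⟩)
    (h.congr fun n => ?_)
  · rw [hl _ (l.get_mem j), one_pow, one_mul]
    exact div_nonneg (pow_pos hq _).le (pow_nonneg (qInt_nonneg hq _) _)
  · simp only [mem_subtype, mem_gapTuples_zero] at hk ⊢
    exact ⟨hk.1, fun j => (hk.2 j).trans hab⟩
  · simp only [mem_subtype, mem_gapTuples_zero]
    exact ⟨k.2, fun j => single_le_sum (fun _ _ => Nat.zero_le _) (mem_univ j)⟩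
  · exact (sum_subtype_of_mem (qTerm q l.get) fun k hk => (mem_gapTuples_zero.1 hk).1).symm

theorem Expands.qStar_eq (hq : 0 < q) (hq1 : q ≤ 1) {l : List SignedNat} {W : List OpenIndex}
    (h : Expands l W) (hW : ∀ w ∈ W, MollConverges q w.close.s w.close.t w.close.r) :
    QStarConverges q l.get ∧
      qStar q l.get = (W.map fun w => moll q w.close.s w.close.t w.close.r).sum := by
  have hlim : Tendsto (fun n => truncStar q n l) atTop
      (𝓝 (W.map fun w => moll q w.close.s w.close.t w.close.r).sum) := by
    simp only [h.truncStar_eq hq, OpenIndex.transform_coeff hq]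
    exact tendsto_list_sum W fun w hw => tendsto_sum_kernel_mul_mollTerm hq hq1 (hW w hw)
  have hsum := hasSum_qTerm_of_tendsto_truncStar hq h.sgn_eq_one hlim
  exact ⟨hsum.summable, hsum.tsum_eq⟩

/-! ### Absolute convergence -/

lemma summable_prod_apply {g : ℕ → ℝ} (hg0 : ∀ n, 0 ≤ g n) (hg : Summable g) (m : ℕ) :
    Summable fun k : Fin m → ℕ => ∏ j, g (k j) := by
  induction m with
  | zero => exact .of_finite
  | succ m ih =>
    rw [← (Fin.consEquiv fun _ : Fin (m + 1) => ℕ).summable_iff]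
    refine (hg.mul_of_nonneg ih hg0 fun k => prod_nonneg fun j _ => hg0 _).congr fun p => ?_
    simp [Fin.prod_univ_succ, Fin.consEquiv]

lemma le_prod_rpow_inv_card {ι : Type*} [Fintype ι] [Nonempty ι] {x : ι → ℝ} {y : ℝ} (hy : 0 ≤ y)
    (h : ∀ i, y ≤ x i) : y ≤ ∏ i, x i ^ (Fintype.card ι : ℝ)⁻¹ := by
  calc y = ∏ _i : ι, y ^ (Fintype.card ι : ℝ)⁻¹ := by
        rw [prod_const, card_univ, Real.rpow_inv_natCast_pow hy Fintype.card_ne_zero]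
    _ ≤ ∏ i, x i ^ (Fintype.card ι : ℝ)⁻¹ :=
        prod_le_prod (fun _ _ => Real.rpow_nonneg hy _) fun i _ =>
          Real.rpow_le_rpow hy (h i) (by positivity)

/-- The decay `y` in the largest index is shared out equally among all the indices. -/
lemma summable_strictTuple_of_norm_le {m : ℕ} {F : StrictTuple (m + 1) → ℝ} {y g : ℕ → ℝ}
    (hy0 : ∀ n, 0 ≤ y n) (hy : AntitoneOn y (Set.Ici 1)) (hg0 : ∀ n, 0 ≤ g n)
    (hsum : Summable fun n => y n ^ ((m + 1 : ℕ) : ℝ)⁻¹ * g n)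
    (hF : ∀ k, ‖F k‖ ≤ y (k.1 0) * ∏ j, g (k.1 j)) : Summable F := by
  have hpi := summable_prod_apply (fun n => mul_nonneg (Real.rpow_nonneg (hy0 n) _) (hg0 n))
    hsum (m + 1)
  refine .of_norm_bounded (hpi.comp_injective Subtype.val_injective) fun k => (hF k).trans ?_
  have hshare := le_prod_rpow_inv_card (hy0 (k.1 0)) fun j =>
    hy (k.2.2 j) (k.2.2 0) (k.2.1.antitone (Fin.zero_le j))
  rw [Fintype.card_fin] at hshare
  rw [Function.comp_apply, prod_mul_distrib]
  exact mul_le_mul_of_nonneg_right hshare (prod_nonneg fun j _ => hg0 _)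

lemma abs_sgn_pow (s : SignedNat) (k : ℕ) : |s.sgn ^ k| = 1 := by
  cases s <;> simp [SignedNat.sgn]

theorem eulerConverges_of_two_le_abs_zero {m : ℕ} {s : Fin (m + 1) → SignedNat}
    (h0 : 2 ≤ (s 0).abs) (h : ∀ j, 1 ≤ (s j).abs) : EulerConverges s := by
  have hsum : Summable fun n : ℕ => ((n : ℝ)⁻¹) ^ ((m + 1 : ℕ) : ℝ)⁻¹ * (n : ℝ)⁻¹ := by
    have hexp : (1 : ℝ) < ((m + 1 : ℕ) : ℝ)⁻¹ + 1 := lt_add_of_pos_left 1 (by positivity)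
    refine (Real.summable_nat_rpow_inv.2 hexp).congr fun n => ?_
    rcases n.eq_zero_or_pos with rfl | hn
    · rw [Nat.cast_zero, inv_zero, mul_zero, Real.zero_rpow (by positivity), inv_zero]
    · rw [Real.rpow_add_one (by positivity), mul_inv, Real.inv_rpow (by positivity)]
  refine summable_strictTuple_of_norm_le (fun n => by positivity)
    (fun a ha b _ hab => inv_anti₀ (by exact_mod_cast ha) (by exact_mod_cast hab))
    (fun n => by positivity) hsum fun k => ?_
  have hk (j : Fin (m + 1)) : (1 : ℝ) ≤ k.1 j := by exact_mod_cast k.2.2 j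
  have hfactor (j : Fin (m + 1)) (a : ℕ) (ha : a ≤ (s j).abs) :
      |(s j).sgn ^ k.1 j / (k.1 j : ℝ) ^ (s j).abs| ≤ ((k.1 j : ℝ) ^ a)⁻¹ := by
    rw [abs_div, abs_sgn_pow, one_div, abs_of_nonneg (by positivity)]
    exact inv_anti₀ (pow_pos (one_pos.trans_le (hk j)) a) (pow_le_pow_right₀ (hk j) ha)
  rw [eulerTerm, norm_prod, Fin.prod_univ_succ, Fin.prod_univ_succ, ← mul_assoc, ← mul_inv, ← sq]
  exact mul_le_mul (hfactor 0 2 h0) (prod_le_prod (fun _ _ => norm_nonneg _) fun j _ =>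
    (hfactor j.succ 1 (h _)).trans_eq (by rw [pow_one])) (prod_nonneg fun _ _ => norm_nonneg _)
    (by positivity)

lemma abs_mollFactor_le (hq : 0 < q) (hq1 : q ≤ 1) (e : MollEntry) {k : ℕ} (hk : 1 ≤ k) :
    |mollFactor q e k| ≤ q ^ ((e.t : ℤ) * (k : ℤ) + Q e.r k) * 2 := by
  have hexp : 0 < q ^ ((e.t : ℤ) * (k : ℤ) + Q e.r k) := zpow_pos hq _
  have hqk : 1 + q ^ k ≤ 2 := by linarith [pow_le_one₀ (n := k) hq.le hq1]
  rw [mollFactor, abs_div, abs_mul, abs_mul, abs_sgn_pow, one_mul, abs_of_pos hexp,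
    abs_of_pos (by positivity), abs_of_pos (pow_pos (qInt_pos hq hk) _)]
  exact (div_le_self (by positivity) (one_le_pow₀ (one_le_qInt hq hk))).trans
    (mul_le_mul_of_nonneg_left hqk hexp.le)

lemma prod_zpow_eq_zpow_sum {ι G₀ : Type*} [CommGroupWithZero G₀] {x : G₀} (hx : x ≠ 0)
    (u : Finset ι) (f : ι → ℤ) : ∏ i ∈ u, x ^ f i = x ^ ∑ i ∈ u, f i := by
  classical
  induction u using Finset.induction_on with
  | empty => simp
  | insert i u hi ih => rw [prod_insert hi, sum_insert hi, ih, zpow_add₀ hx]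

/-- The exponent of `q` in `mollTerm`. -/
def mollExponent {m : ℕ} (t : Fin m → ℕ) (r : Fin m → IntTheta) (k : Fin m → ℕ) : ℤ :=
  ∑ j, ((t j : ℤ) * (k j : ℤ) + Q (r j) (k j))

theorem mollConverges_of_le_mollExponent (hq : 0 < q) (hq1 : q < 1) {m : ℕ}
    {s : Fin (m + 1) → SignedNat} {t : Fin (m + 1) → ℕ} {r : Fin (m + 1) → IntTheta}
    (h : ∀ k : StrictTuple (m + 1), (k.1 0 : ℤ) ≤ mollExponent t r k.1) :
    MollConverges q s t r := by
  have hsum : Summable fun n : ℕ => (q ^ n) ^ ((m + 1 : ℕ) : ℝ)⁻¹ * 2 := by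
    refine ((summable_geometric_of_lt_one (Real.rpow_nonneg hq.le ((m + 1 : ℕ) : ℝ)⁻¹)
      (Real.rpow_lt_one hq.le hq1 (by positivity))).mul_right 2).congr fun n => ?_
    rw [Real.rpow_pow_comm hq.le]
  refine summable_strictTuple_of_norm_le (fun n => by positivity)
    (fun a _ b _ hab => pow_le_pow_of_le_one hq.le hq1.le hab) (fun _ => zero_le_two) hsum
    fun k => ?_
  calc ‖mollTerm q s t r k.1‖ = ∏ j, |mollFactor q ⟨s j, t j, r j⟩ (k.1 j)| := norm_prod _ _
    _ ≤ ∏ j, q ^ ((t j : ℤ) * (k.1 j : ℤ) + Q (r j) (k.1 j)) * 2 :=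
        prod_le_prod (fun _ _ => abs_nonneg _) fun j _ =>
          abs_mollFactor_le hq hq1.le ⟨s j, t j, r j⟩ (k.2.2 j)
    _ = q ^ mollExponent t r k.1 * ∏ _j : Fin (m + 1), 2 := by
        rw [prod_mul_distrib, prod_zpow_eq_zpow_sum hq.ne', mollExponent]
    _ ≤ q ^ k.1 0 * ∏ _j : Fin (m + 1), 2 := by
        rw [← zpow_natCast]
        exact mul_le_mul_of_nonneg_right (zpow_le_zpow_right_of_le_one₀ hq hq1.le (h k))
          (by positivity)

lemma OpenIndex.mollExponent_close (w : OpenIndex) (k : Fin (w.tail.length + 1) → ℕ) :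
    mollExponent w.close.t w.close.r k =
      (w.t * k 0 + w.s.barShift (k 0) + 2 * (k 0).choose 2) +
        mollExponent w.tail.t w.tail.r (Fin.tail k) := by
  rw [add_assoc (_ * _), ← w.s.Q_leadingTheta]
  exact Fin.sum_univ_succ (n := w.tail.length) _

lemma mollExponent_cons (e : MollEntry) (I : MollIndex) (k : Fin (I.length + 1) → ℕ) :
    mollExponent (MollIndex.t (e :: I)) (MollIndex.r (e :: I)) k =
      (e.t * k 0 + Q e.r (k 0)) + mollExponent I.t I.r (Fin.tail k) :=
  Fin.sum_univ_succ (n := I.length) _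

namespace OpenIndex

/-- The words for which the exponent of `q` in the completed sum is at least `t k₁`, already for
weakly decreasing indices, so that `𝔷` converges for `0 < q < 1`. -/
def Admissible (w : OpenIndex) : Prop :=
  1 ≤ w.t ∧ ∀ k : Fin (w.tail.length + 1) → ℕ, Antitone k →
    0 ≤ w.s.barShift (k 0) + 2 * (k 0).choose 2 + mollExponent w.tail.t w.tail.r (Fin.tail k)

lemma admissible_one : Admissible ⟨.pos 1, 1, []⟩ :=
  ⟨le_rfl, fun k _ => by simp [SignedNat.barShift, mollExponent]⟩

lemma Admissible.raise {w : OpenIndex} (hw : w.Admissible) (m : ℕ) : (w.raise m).Admissible :=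
  ⟨Nat.le_succ_of_le hw.1, by rcases w with ⟨_ | _, _, _⟩ <;> exact hw.2⟩

lemma Admissible.consOne {w : OpenIndex} (hw : w.Admissible) : w.consOne.Admissible := by
  refine ⟨le_rfl, fun (k : Fin (w.tail.length + 1 + 1) → ℕ) hk => ?_⟩
  have htail := hw.2 (Fin.tail k) (hk.comp_monotone Fin.strictMono_succ.monotone)
  have hchoose : (Fin.tail k 0).choose 2 ≤ (k 0).choose 2 :=
    Nat.choose_le_choose 2 (hk (Fin.zero_le _))
  have ht : Fin.tail k 0 ≤ w.t * Fin.tail k 0 := Nat.le_mul_of_pos_left _ hw.1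
  refine le_of_le_of_eq ?_ (congrArg (0 + 2 * ((k 0).choose 2 : ℤ) + ·)
    (mollExponent_cons ⟨w.s, w.t, w.s.thetaBehindOne⟩ w.tail (Fin.tail k)).symm)
  rw [SignedNat.Q_thetaBehindOne]
  zify at hchoose ht
  linarith

lemma Admissible.consThree {w : OpenIndex} (hw : w.Admissible) : w.consThree.Admissible := by
  refine ⟨le_rfl, fun (k : Fin (w.tail.length + 1 + 1) → ℕ) hk => ?_⟩
  have htail := hw.2 (Fin.tail k) (hk.comp_monotone Fin.strictMono_succ.monotone)
  have hchoose : (Fin.tail k 0).choose 2 ≤ (k 0).choose 2 :=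
    Nat.choose_le_choose 2 (hk (Fin.zero_le _))
  have ht : 0 ≤ w.t * Fin.tail k 0 := Nat.zero_le _
  refine le_of_le_of_eq ?_ (congrArg (-((k 0).choose 2 : ℤ) + 2 * ((k 0).choose 2 : ℤ) + ·)
    (mollExponent_cons ⟨w.s.flip.raise 1, w.t, w.s.thetaBehindThree⟩ w.tail (Fin.tail k)).symm)
  rw [SignedNat.Q_thetaBehindThree]
  zify at hchoose ht
  linarith

end OpenIndex

namespace Expands

variable {l : List SignedNat} {W : List OpenIndex}

lemma mollConverges (hq : 0 < q) (hq1 : q < 1) (h : Expands l W) :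
    ∀ w ∈ W, MollConverges q w.close.s w.close.t w.close.r := by
  intro w hw
  obtain ⟨ht, hexp⟩ := h.forall_mem OpenIndex.admissible_one (fun m _ h => h.raise m)
    (fun _ h => h.consOne) (fun _ h => h.consThree) w hw
  refine mollConverges_of_le_mollExponent hq hq1 (m := w.tail.length) fun k => ?_
  have hk : k.1 0 ≤ w.t * k.1 0 := Nat.le_mul_of_pos_left _ ht
  have htail := hexp k.1 k.2.1.antitone
  refine le_of_le_of_eq ?_ (w.mollExponent_close k.1).symm
  zify at hk
  linarith

lemma one_le_abs (h : Expands l W) : ∀ w ∈ W, ∀ e ∈ w.close, 1 ≤ e.s.abs :=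
  h.forall_mem (by simp [OpenIndex.close, SignedNat.abs])
    (fun m w hw => by
      simp only [OpenIndex.close, OpenIndex.raise, List.forall_mem_cons,
        SignedNat.abs_raise] at hw ⊢
      exact ⟨Nat.le_add_right_of_le hw.1, hw.2⟩)
    (fun w hw => List.forall_mem_cons.2
      ⟨le_rfl, List.forall_mem_cons.2 (List.forall_mem_cons.1 hw)⟩)
    (fun w hw => by
      simp only [OpenIndex.close, OpenIndex.consThree, List.forall_mem_cons,
        SignedNat.abs_raise] at hw ⊢
      exact ⟨one_le_two, Nat.le_add_left _ _, hw.2⟩)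

lemma two_le_abs {s : SignedNat} (h : Expands (s :: l) W) (hs : 2 ≤ s.abs) :
    ∀ w ∈ W, 2 ≤ w.s.abs := by
  have hraise (m : ℕ) (hm : 2 ≤ m) (W' : List OpenIndex) :
      ∀ w ∈ W'.map (OpenIndex.raise m), 2 ≤ w.s.abs := List.forall_mem_map.2 fun w _ => by
    rw [OpenIndex.raise, SignedNat.abs_raise]
    exact Nat.le_add_left_of_le hm
  cases h with
  | one => simp [SignedNat.abs] at hs
  | cons_two h => exact hraise 2 le_rfl _
  | cons_one h => simp [SignedNat.abs] at hs
  | cons_three h =>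
    exact List.forall_mem_append.2
      ⟨hraise 3 (by lia) _, List.forall_mem_map.2 fun _ _ => le_rfl⟩

lemma eulerConverges {s : SignedNat} (h : Expands (s :: l) W) (hs : 2 ≤ s.abs) :
    ∀ w ∈ W, EulerConverges w.close.s := fun w hw =>
  eulerConverges_of_two_le_abs_zero (m := w.tail.length) (h.two_le_abs hs w hw)
    (MollIndex.forall_vec (p := fun s : SignedNat => 1 ≤ s.abs) (h.one_le_abs w hw))

end Expands

/-! ### The classical case `q = 1` -/

lemma qTerm_one {m : ℕ} (s : Fin m → SignedNat) : qTerm 1 s = eulerTerm s := by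
  funext k
  simp [qTerm, eulerTerm, qInt_one_left]

lemma mollTerm_one {m : ℕ} (s : Fin m → SignedNat) (t : Fin m → ℕ) (r : Fin m → IntTheta)
    (k : Fin m → ℕ) : mollTerm 1 s t r k = 2 ^ m * eulerTerm s k := by
  simp [mollTerm, eulerTerm, qInt_one_left, mul_div_right_comm, prod_mul_distrib,
    mul_comm _ (2 ^ m : ℝ), one_add_one_eq_two]

lemma moll_one {m : ℕ} (s : Fin m → SignedNat) (t : Fin m → ℕ) (r : Fin m → IntTheta) :
    moll 1 s t r = 2 ^ m * euler s := by
  simp only [moll, euler, mollTerm_one, tsum_mul_left]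

lemma EulerConverges.mollConverges_one {m : ℕ} {s : Fin m → SignedNat} (h : EulerConverges s)
    (t : Fin m → ℕ) (r : Fin m → IntTheta) : MollConverges 1 s t r := by
  simp only [MollConverges, mollTerm_one]
  exact h.mul_left _

theorem Expands.eulerStar_eq {l : List SignedNat} {W : List OpenIndex} (h : Expands l W)
    (hW : ∀ w ∈ W, EulerConverges w.close.s) :
    EulerStarConverges l.get ∧
      eulerStar l.get = (W.map fun w => 2 ^ w.close.length * euler w.close.s).sum := by
  simpa only [QStarConverges, qStar, qTerm_one, moll_one, EulerStarConverges, eulerStar] using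
    h.qStar_eq one_pos le_rfl fun w hw => (hW w hw).mollConverges_one _ _

/-! ### The string `({2}^a, 1, {2}^b, 1, {2}^c, 3, {2}^d, 1)` -/

lemma Expands.replicate_two {l : List SignedNat} {W : List OpenIndex} (h : Expands l W) (n : ℕ) :
    Expands (List.replicate n (.pos 2) ++ l)
      (W.map fun w => ⟨w.s.raise (2 * n), w.t + n, w.tail⟩) := by
  induction n with
  | zero =>
    have hid (w : OpenIndex) : (⟨w.s.raise 0, w.t, w.tail⟩ : OpenIndex) = w := by
      rcases w with ⟨_ | _, _, _⟩ <;> rfl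
    simpa [hid] using h
  | succ n ih =>
    have hsucc (w : OpenIndex) : OpenIndex.raise 2 ⟨w.s.raise (2 * n), w.t + n, w.tail⟩ =
        ⟨w.s.raise (2 * (n + 1)), w.t + (n + 1), w.tail⟩ := by
      rcases w with ⟨_ | _, _, _⟩ <;> rfl
    simpa [List.replicate_succ, Function.comp_def, hsucc] using ih.cons_two

/-- The words of the expansion of `keyString a b c d`. -/
def keyIndices (a b c d : ℕ) : List OpenIndex :=
  [⟨.pos (2 * a + 2 * b + 2 * c + 2 * d + 6), a + b + c + d + 4, []⟩,
    ⟨.bar (2 * a + 2 * b + 2 * c + 4), a + b + c + 3, [⟨.bar (2 * d + 2), d + 1, .int 1⟩]⟩,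
    ⟨.pos (2 * a + 2 * b + 2), a + b + 2, [⟨.pos (2 * c + 2 * d + 4), c + d + 2, .int 0⟩]⟩,
    ⟨.pos (2 * a + 2 * b + 2), a + b + 2,
      [⟨.bar (2 * c + 2), c + 1, .int (-1)⟩, ⟨.bar (2 * d + 2), d + 1, .int 1⟩]⟩,
    ⟨.pos (2 * a + 1), a + 1, [⟨.pos (2 * b + 2 * c + 2 * d + 5), b + c + d + 3, .int 0⟩]⟩,
    ⟨.pos (2 * a + 1), a + 1,
      [⟨.bar (2 * b + 2 * c + 3), b + c + 2, .int (-1)⟩, ⟨.bar (2 * d + 2), d + 1, .int 1⟩]⟩,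
    ⟨.pos (2 * a + 1), a + 1,
      [⟨.pos (2 * b + 1), b + 1, .int 0⟩, ⟨.pos (2 * c + 2 * d + 4), c + d + 2, .int 0⟩]⟩,
    ⟨.pos (2 * a + 1), a + 1,
      [⟨.pos (2 * b + 1), b + 1, .int 0⟩, ⟨.bar (2 * c + 2), c + 1, .int (-1)⟩,
        ⟨.bar (2 * d + 2), d + 1, .int 1⟩]⟩]

theorem expands_keyString (a b c d : ℕ) : Expands (keyString a b c d) (keyIndices a b c d) := by
  have h := ((((((Expands.one.replicate_two d).cons_three).replicate_two c).cons_one).replicate_two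
    b).cons_one).replicate_two a
  convert h using 1
  · simp [keyString]
  · simp [keyIndices, OpenIndex.raise, OpenIndex.consOne, OpenIndex.consThree, SignedNat.raise,
      SignedNat.flip, SignedNat.thetaBehindOne, SignedNat.thetaBehindThree]
    lia

end QMZV

theorem mainTheorem10 (a b c d : ℕ) :
    -- the classical identity, for `a ≥ 1`
    (1 ≤ a →
      EulerStarConverges (keyString a b c d).get ∧
      EulerConverges ![.pos (2*a+2*b+2*c+2*d+6)] ∧
      EulerConverges ![.pos (2*a+1), .pos (2*b+2*c+2*d+5)] ∧
      EulerConverges ![.pos (2*a+2*b+2), .pos (2*c+2*d+4)] ∧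
      EulerConverges ![.bar (2*a+2*b+2*c+4), .bar (2*d+2)] ∧
      EulerConverges ![.pos (2*a+1), .pos (2*b+1), .pos (2*c+2*d+4)] ∧
      EulerConverges ![.pos (2*a+1), .bar (2*b+2*c+3), .bar (2*d+2)] ∧
      EulerConverges ![.pos (2*a+2*b+2), .bar (2*c+2), .bar (2*d+2)] ∧
      EulerConverges ![.pos (2*a+1), .pos (2*b+1), .bar (2*c+2), .bar (2*d+2)] ∧
      eulerStar (keyString a b c d).get =
        2 * euler ![.pos (2*a+2*b+2*c+2*d+6)]
        + 4 * euler ![.pos (2*a+1), .pos (2*b+2*c+2*d+5)]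
        + 4 * euler ![.pos (2*a+2*b+2), .pos (2*c+2*d+4)]
        + 4 * euler ![.bar (2*a+2*b+2*c+4), .bar (2*d+2)]
        + 8 * euler ![.pos (2*a+1), .pos (2*b+1), .pos (2*c+2*d+4)]
        + 8 * euler ![.pos (2*a+1), .bar (2*b+2*c+3), .bar (2*d+2)]
        + 8 * euler ![.pos (2*a+2*b+2), .bar (2*c+2), .bar (2*d+2)]
        + 16 * euler ![.pos (2*a+1), .pos (2*b+1), .bar (2*c+2), .bar (2*d+2)]) ∧
    -- the `q`-analog, for all `a ≥ 0`
    (∀ q : ℝ, 0 < q → q < 1 →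
      QStarConverges q (keyString a b c d).get ∧
      MollConverges q ![.pos (2*a+2*b+2*c+2*d+6)] ![a+b+c+d+4] ![.int 2] ∧
      MollConverges q ![.pos (2*a+1), .pos (2*b+2*c+2*d+5)] ![a+1, b+c+d+3] ![.int 2, .int 0] ∧
      MollConverges q ![.pos (2*a+2*b+2), .pos (2*c+2*d+4)] ![a+b+2, c+d+2] ![.int 2, .int 0] ∧
      MollConverges q ![.bar (2*a+2*b+2*c+4), .bar (2*d+2)] ![a+b+c+3, d+1] ![.int 1, .int 1] ∧
      MollConverges q ![.pos (2*a+1), .pos (2*b+1), .pos (2*c+2*d+4)]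
        ![a+1, b+1, c+d+2] ![.int 2, .int 0, .int 0] ∧
      MollConverges q ![.pos (2*a+1), .bar (2*b+2*c+3), .bar (2*d+2)]
        ![a+1, b+c+2, d+1] ![.int 2, .int (-1), .int 1] ∧
      MollConverges q ![.pos (2*a+2*b+2), .bar (2*c+2), .bar (2*d+2)]
        ![a+b+2, c+1, d+1] ![.int 2, .int (-1), .int 1] ∧
      MollConverges q ![.pos (2*a+1), .pos (2*b+1), .bar (2*c+2), .bar (2*d+2)]
        ![a+1, b+1, c+1, d+1] ![.int 2, .int 0, .int (-1), .int 1] ∧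
      qStar q (keyString a b c d).get =
        moll q ![.pos (2*a+2*b+2*c+2*d+6)] ![a+b+c+d+4] ![.int 2]
        + moll q ![.pos (2*a+1), .pos (2*b+2*c+2*d+5)] ![a+1, b+c+d+3] ![.int 2, .int 0]
        + moll q ![.pos (2*a+2*b+2), .pos (2*c+2*d+4)] ![a+b+2, c+d+2] ![.int 2, .int 0]
        + moll q ![.bar (2*a+2*b+2*c+4), .bar (2*d+2)] ![a+b+c+3, d+1] ![.int 1, .int 1]
        + moll q ![.pos (2*a+1), .pos (2*b+1), .pos (2*c+2*d+4)]
            ![a+1, b+1, c+d+2] ![.int 2, .int 0, .int 0]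
        + moll q ![.pos (2*a+1), .bar (2*b+2*c+3), .bar (2*d+2)]
            ![a+1, b+c+2, d+1] ![.int 2, .int (-1), .int 1]
        + moll q ![.pos (2*a+2*b+2), .bar (2*c+2), .bar (2*d+2)]
            ![a+b+2, c+1, d+1] ![.int 2, .int (-1), .int 1]
        + moll q ![.pos (2*a+1), .pos (2*b+1), .bar (2*c+2), .bar (2*d+2)]
            ![a+1, b+1, c+1, d+1] ![.int 2, .int 0, .int (-1), .int 1]) := by
  have hexpands := expands_keyString a b c d
  refine ⟨fun ha => ?_, fun q hq hq1 => ?_⟩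
  · obtain ⟨a, rfl⟩ := Nat.exists_eq_add_of_le' ha
    have hconv := Expands.eulerConverges hexpands le_rfl
    obtain ⟨hstar, heq⟩ := hexpands.eulerStar_eq hconv
    simp only [keyIndices, List.forall_mem_cons] at hconv
    obtain ⟨h1, h4, h3, h7, h2, h6, h5, h8, -⟩ := hconv
    refine ⟨hstar, h1, h2, h3, h4, h5, h6, h7, h8, heq.trans ?_⟩
    simp only [keyIndices, List.map_cons, List.map_nil, List.sum_cons, List.sum_nil,
      OpenIndex.close, MollIndex.vec, List.length_cons, List.length_nil]
    ring
  · have hconv := hexpands.mollConverges hq hq1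
    obtain ⟨hstar, heq⟩ := hexpands.qStar_eq hq hq1.le hconv
    simp only [keyIndices, List.forall_mem_cons] at hconv
    obtain ⟨h1, h4, h3, h7, h2, h6, h5, h8, -⟩ := hconv
    refine ⟨hstar, h1, h2, h3, h4, h5, h6, h7, h8, heq.trans ?_⟩
    simp only [keyIndices, List.map_cons, List.map_nil, List.sum_cons, List.sum_nil,
      OpenIndex.close, MollIndex.vec, SignedNat.leadingTheta, List.length_cons, List.length_nil]
    ring
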